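/- For $n\ge 0$ let $A_n=\sum_{k=0}^{n}\binom{n+k}{k}^2\binom{n}{k}^2$ be the $n$-th Apéry number and $H_n=\sum_{k=1}^{n}\frac1k$ the $n$-th harmonic number, and let $B_0,B_1,B_2,\ldots$ be the Bernoulli numbers, defined by $B_0=1$ and $\sum_{k=0}^{n-1}\binom{n}{k}B_k=0$ for $n\ge 2$. Then for every prime $p\ge 5$, $$\sum_{k=0}^{p-1}(2k+1)^3A_k\equiv p^3+4p^4H_{p-1}+\frac65\,p^8B_{p-5}\pmod{p^9},$$ where, for rational numbers $a,b$, the congruence $a\equiv b\pmod{p^9}$ means that $a-b=p^9r$ for some rational number $r$ whose denominator in lowest terms is not divisible by $p$. -/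

import Mathlib

/-- The Apéry numbers `A_n = ∑_{k=0}^n C(n+k,k)² C(n,k)²`. -/
def aperyNumber (n : ℕ) : ℕ :=
  ∑ k ∈ Finset.range (n + 1), (n + k).choose k ^ 2 * n.choose k ^ 2

/-- Congruence of rational numbers modulo `p ^ m`, where `p` is a prime: `a ≡ b (mod p ^ m)` means
that `a - b = p ^ m * r` for some `p`-integral rational number `r`, that is, one whose denominator
in lowest terms is not divisible by `p`. -/
def RatModEqPrimePow (p m : ℕ) (a b : ℚ) : Prop :=
  ∃ r : ℚ, ¬ p ∣ r.den ∧ a - b = (p : ℚ) ^ m * r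

/-! ### An exact formula for the sum -/

open Finset

/-! Expand each Apéry number as a sum of `chooseProd k j ^ 2` and exchange summations. The sum over
`k` has a closed form for each `j` (`sum_odd_cube_mul_chooseProd_sq`), and summation by telescoping
in `j` gives the exact identity `sum_odd_cube_mul_aperyNumber`, with prefactor `n ^ 6`.

For `n = p`, the term `j = p - 1` carries `p ^ (-3)`. Expanding the products in powers of `p ^ 2`
leaves, modulo `p ^ 9`, `p³ - 2p⁵H₂ + p⁶H₃ + p⁷(2H₂² - H₄) - 2p⁸H(2,3)`, where `Hₐ` and `H(a,b)` are
the simple and double harmonic sums up to `p - 1`. The reflection `i ↦ p - i` trades `H₂` for `H₁`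
and `H₃` for `H₄`. For `p ≥ 7`, what remains follows from `H₄ ≡ (4/5) p B_{p-5}` modulo `p ^ 2` and
`H(2,3) ≡ -2 B_{p-5}` modulo `p`; the case `p = 5` is a computation. -/

/-- The polynomial `C(x+j,j) C(x,j)` in `x`, as a product. -/
def chooseProd (x : ℚ) (j : ℕ) : ℚ :=
  ∏ i ∈ range j, (x - i) * (x + i + 1) / ((i : ℚ) + 1) ^ 2

/-- The product `∏_{i=1}^j (x / i² - 1)`. -/
def squareProd (x : ℚ) (j : ℕ) : ℚ :=
  ∏ i ∈ range j, (x / ((i : ℚ) + 1) ^ 2 - 1)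

theorem cast_add_choose_mul_choose (k j : ℕ) :
    (((k + j).choose j * k.choose j : ℕ) : ℚ) = chooseProd k j := by
  induction j with
  | zero => simp [chooseProd]
  | succ j ih =>
    have h1 : ((k + (j + 1)).choose (j + 1) : ℚ) * (j + 1) = (k + j + 1) * (k + j).choose j := by
      have := Nat.add_one_mul_choose_eq (k + j) j
      rw [← add_assoc]
      exact_mod_cast this.symm
    have h2 : (k.choose (j + 1) : ℚ) * (j + 1) = k.choose j * (k - j) := by
      rcases le_or_gt j k with h | h
      · have := Nat.choose_succ_right_eq k j
        rw [← Nat.cast_sub h]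
        exact_mod_cast this
      · simp [Nat.choose_eq_zero_of_lt h, Nat.choose_eq_zero_of_lt (Nat.lt_succ_of_lt h)]
    have hj : (j : ℚ) + 1 ≠ 0 := by positivity
    rw [chooseProd, prod_range_succ, ← chooseProd, ← ih]
    push_cast
    field_simp
    linear_combination ((k.choose (j + 1) : ℚ) * (j + 1)) * h1 +
      ((k + j + 1) * (k + j).choose j : ℚ) * h2

theorem mul_squareProd_sq (x : ℚ) (j : ℕ) :
    x * squareProd (x ^ 2) j = (x - j) * chooseProd x j := by
  induction j with
  | zero => simp [chooseProd, squareProd]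
  | succ j ih =>
    have hj : (j : ℚ) + 1 ≠ 0 := by positivity
    rw [chooseProd, squareProd, prod_range_succ, prod_range_succ, ← chooseProd, ← squareProd,
      ← mul_assoc, ih]
    push_cast
    field_simp
    ring

theorem add_one_mul_squareProd_sq (x : ℚ) (j : ℕ) :
    (x + 1) * squareProd ((x + 1) ^ 2) j = (x + 1 + j) * chooseProd x j := by
  induction j with
  | zero => simp [chooseProd, squareProd]
  | succ j ih =>
    have hj : (j : ℚ) + 1 ≠ 0 := by positivity
    rw [chooseProd, squareProd, prod_range_succ, prod_range_succ, ← chooseProd, ← squareProd,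
      ← mul_assoc, ih]
    push_cast
    field_simp
    ring

/-- The closed form telescopes in `n`: the two preceding lemmas write its values at `n` and `n + 1`
in terms of the same `chooseProd n j`, leaving a rational identity in `n` and `j`. -/
theorem sum_odd_cube_mul_chooseProd_sq (n j : ℕ) :
    ∑ k ∈ range n, (2 * (k : ℚ) + 1) ^ 3 * chooseProd k j ^ 2 =
      (2 * (n : ℚ) ^ 2 / (j + 1) - 1) * (n * squareProd ((n : ℚ) ^ 2) j) ^ 2 := by
  induction n with
  | zero => simp
  | succ n ih =>
    have hj : (j : ℚ) + 1 ≠ 0 := by positivity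
    rw [sum_range_succ, ih]
    push_cast
    rw [add_one_mul_squareProd_sq, mul_squareProd_sq]
    field_simp
    ring

theorem aperyNumber_eq_sum_chooseProd {n k : ℕ} (h : k < n) :
    (aperyNumber k : ℚ) = ∑ j ∈ range n, chooseProd k j ^ 2 := by
  rw [aperyNumber, ← sum_subset (range_subset_range.2 h)]
  · push_cast
    refine sum_congr rfl fun j _ => ?_
    rw [← cast_add_choose_mul_choose]
    push_cast
    ring
  · intro j _ hj
    rw [← cast_add_choose_mul_choose, Nat.choose_eq_zero_of_lt (n := k) (k := j)]
    · simp
    · simpa using hj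

theorem sum_squareProd_telescope (x : ℚ) (n : ℕ) :
    ∑ j ∈ range n, (2 * x / ((j : ℚ) + 1) - 1) * squareProd x j ^ 2 =
      x ^ 2 * ∑ j ∈ range n, squareProd x j ^ 2 / ((j : ℚ) + 1) ^ 3 - n * squareProd x n ^ 2 := by
  induction n with
  | zero => simp
  | succ n ih =>
    have hj : (n : ℚ) + 1 ≠ 0 := by positivity
    rw [sum_range_succ, sum_range_succ, ih]
    have : squareProd x (n + 1) = squareProd x n * (x / ((n : ℚ) + 1) ^ 2 - 1) := by
      rw [squareProd, prod_range_succ, ← squareProd]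
    rw [this]
    push_cast
    field_simp
    ring

theorem sum_odd_cube_mul_aperyNumber (n : ℕ) :
    ∑ k ∈ range n, (2 * (k : ℚ) + 1) ^ 3 * (aperyNumber k : ℚ) =
      (n : ℚ) ^ 6 * ∑ j ∈ range n, squareProd ((n : ℚ) ^ 2) j ^ 2 / ((j : ℚ) + 1) ^ 3 := by
  rcases n with - | n
  · simp
  -- The last factor is zero, which kills the boundary term of the telescoping in `j`.
  have h0 : squareProd (((n + 1 : ℕ) : ℚ) ^ 2) (n + 1) = 0 := by
    rw [squareProd, prod_range_succ]
    have hj : (n : ℚ) + 1 ≠ 0 := by positivity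
    push_cast
    rw [div_self (pow_ne_zero _ hj), sub_self, mul_zero]
  calc _ = ∑ k ∈ range (n + 1), ∑ j ∈ range (n + 1),
        (2 * (k : ℚ) + 1) ^ 3 * chooseProd k j ^ 2 := by
        refine sum_congr rfl fun k hk => ?_
        rw [aperyNumber_eq_sum_chooseProd (mem_range.1 hk), mul_sum]
    _ = ((n + 1 : ℕ) : ℚ) ^ 2 * ∑ j ∈ range (n + 1),
        (2 * ((n + 1 : ℕ) : ℚ) ^ 2 / ((j : ℚ) + 1) - 1) *
          squareProd (((n + 1 : ℕ) : ℚ) ^ 2) j ^ 2 := by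
        rw [sum_comm, mul_sum]
        refine sum_congr rfl fun j _ => ?_
        rw [sum_odd_cube_mul_chooseProd_sq]
        ring
    _ = _ := by
        rw [sum_squareProd_telescope, h0]
        ring

/-! ### Divisibility of rationals by prime powers, and power sums modulo `p` -/

/-- The rational number `x` is divisible by `p ^ m` in the ring of `p`-integral rationals. -/
def PrimePowDvd (p m : ℕ) (x : ℚ) : Prop :=
  ∃ r : ℚ, ¬ p ∣ r.den ∧ x = (p : ℚ) ^ m * r

namespace PrimePowDvd

variable {p m n : ℕ} {x y : ℚ}

theorem neg (hx : PrimePowDvd p m x) : PrimePowDvd p m (-x) := by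
  obtain ⟨r, hr, rfl⟩ := hx
  exact ⟨-r, by simpa using hr, by ring⟩

theorem mono (h : m ≤ n) (hx : PrimePowDvd p n x) : PrimePowDvd p m x := by
  obtain ⟨k, rfl⟩ := Nat.exists_eq_add_of_le h
  obtain ⟨r, hr, rfl⟩ := hx
  refine ⟨(p : ℚ) ^ k * r, fun h => ?_, by ring⟩
  have hk : ((p : ℚ) ^ k).den = 1 := by
    rw [← Nat.cast_pow]
    exact Rat.den_natCast _
  have := h.trans (Rat.mul_den_dvd _ _)
  rw [hk, one_mul] at this
  exact hr this

variable [hp : Fact p.Prime]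

theorem intCast (z : ℤ) : PrimePowDvd p 0 z :=
  ⟨z, by simpa using hp.out.ne_one, by simp⟩

theorem natCast (k : ℕ) : PrimePowDvd p 0 k := by
  simpa using intCast (p := p) (k : ℤ)

theorem one : PrimePowDvd p 0 1 := by
  simpa using natCast (p := p) 1

theorem ofNat (k : ℕ) [k.AtLeastTwo] : PrimePowDvd p 0 (ofNat(k) : ℚ) :=
  natCast k

theorem inv_natCast {k : ℕ} (hk : ¬ p ∣ k) : PrimePowDvd p 0 ((k : ℚ)⁻¹) := by
  refine ⟨(k : ℚ)⁻¹, fun h => hk ?_, by simp⟩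
  rw [Rat.inv_natCast_den] at h
  split_ifs at h with h0
  · exact absurd (Nat.dvd_one.1 h) hp.out.ne_one
  · exact h

theorem inv_natCast_of_lt {k : ℕ} (h0 : 0 < k) (hk : k < p) : PrimePowDvd p 0 ((k : ℚ)⁻¹) :=
  inv_natCast (Nat.not_dvd_of_pos_of_lt h0 hk)

theorem zero : PrimePowDvd p m 0 :=
  ⟨0, by simpa using hp.out.ne_one, by simp⟩

theorem add (hx : PrimePowDvd p m x) (hy : PrimePowDvd p m y) : PrimePowDvd p m (x + y) := by
  obtain ⟨r, hr, rfl⟩ := hx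
  obtain ⟨s, hs, rfl⟩ := hy
  refine ⟨r + s, fun h => ?_, by ring⟩
  exact (hp.out.dvd_mul.1 (h.trans (Rat.add_den_dvd r s))).elim hr hs

theorem mul (hx : PrimePowDvd p m x) (hy : PrimePowDvd p n y) :
    PrimePowDvd p (m + n) (x * y) := by
  obtain ⟨r, hr, rfl⟩ := hx
  obtain ⟨s, hs, rfl⟩ := hy
  refine ⟨r * s, fun h => ?_, by ring⟩
  exact (hp.out.dvd_mul.1 (h.trans (Rat.mul_den_dvd r s))).elim hr hs

theorem sub (hx : PrimePowDvd p m x) (hy : PrimePowDvd p m y) : PrimePowDvd p m (x - y) := by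
  rw [sub_eq_add_neg]
  exact hx.add hy.neg

theorem mul_left (hx : PrimePowDvd p 0 x) (hy : PrimePowDvd p n y) : PrimePowDvd p n (x * y) := by
  simpa using hx.mul hy

theorem mul_right (hx : PrimePowDvd p n x) (hy : PrimePowDvd p 0 y) :
    PrimePowDvd p n (x * y) := by
  simpa using hx.mul hy

theorem pow (hx : PrimePowDvd p 0 x) (k : ℕ) : PrimePowDvd p 0 (x ^ k) := by
  induction k with
  | zero => simpa using one
  | succ k ih => rw [pow_succ]; exact ih.mul_left hx

theorem prime_pow (m : ℕ) : PrimePowDvd p m ((p : ℚ) ^ m) :=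
  ⟨1, by simpa using hp.out.ne_one, by simp⟩

theorem sum {ι : Type*} {s : Finset ι} {f : ι → ℚ} (h : ∀ i ∈ s, PrimePowDvd p m (f i)) :
    PrimePowDvd p m (∑ i ∈ s, f i) := by
  classical
  induction s using Finset.induction_on with
  | empty => simpa using zero
  | insert a s ha ih =>
    rw [sum_insert ha]
    exact (h a (mem_insert_self a s)).add (ih fun i hi => h i (mem_insert_of_mem hi))

theorem intCast_of_zmod_eq_zero {z : ℤ} (h : (z : ZMod p) = 0) : PrimePowDvd p 1 z := by
  obtain ⟨k, rfl⟩ := (ZMod.intCast_zmod_eq_zero_iff_dvd z p).1 h |>.imp fun _ h => h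
  refine ⟨k, by simpa using hp.out.ne_one, by push_cast; ring⟩

/-- Fermat's little theorem for a negative exponent. -/
theorem pow_sub_inv_pow {k a : ℕ} (h0 : 0 < k) (hk : k < p) (ha : a < p) :
    PrimePowDvd p 1 ((k : ℚ) ^ (p - 1 - a) - 1 / (k : ℚ) ^ a) := by
  have hz : PrimePowDvd p 1 (((k : ℤ) ^ (p - 1) - 1 : ℤ) : ℚ) := by
    apply intCast_of_zmod_eq_zero
    push_cast
    rw [ZMod.pow_card_sub_one_eq_one, sub_self]
    rw [Ne, ZMod.natCast_eq_zero_iff]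
    exact Nat.not_dvd_of_pos_of_lt h0 hk
  have h := ((inv_natCast_of_lt h0 hk).pow a).mul_left hz
  have hk0 : (k : ℚ) ≠ 0 := by positivity
  convert h using 1
  have hs : (k : ℚ) ^ (p - 1) = (k : ℚ) ^ (p - 1 - a) * (k : ℚ) ^ a := by
    rw [← pow_add]
    congr 1
    omega
  push_cast
  rw [hs, inv_pow]
  field_simp

theorem sum_pow_zmod (l : ℕ) :
    ∑ j ∈ range (p - 1), ((j + 1 : ℕ) : ZMod p) ^ l = if (p - 1) ∣ l then -1 else 0 := by
  have hu := FiniteField.sum_pow_units (ZMod p) l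
  rw [ZMod.card p] at hu
  rw [← hu]
  refine Finset.sum_bij'
    (fun v hv => Units.mk0 ((v + 1 : ℕ) : ZMod p) (mt (ZMod.natCast_eq_zero_iff (v + 1) p).mp
      (Nat.not_dvd_of_pos_of_lt v.succ_pos (by have := mem_range.1 hv; omega))))
    (fun u _ => (u : ZMod p).val - 1)
    (fun _ _ => Finset.mem_univ _) ?_ ?_ ?_ (fun _ _ => rfl)
  · intro u _
    have := ZMod.val_lt (u : ZMod p)
    have := (ZMod.val_ne_zero (u : ZMod p)).2 u.ne_zero
    rw [mem_range]
    omega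
  · intro v hv
    have := mem_range.1 hv
    have h : v + 1 < p := by omega
    simp only [Units.val_mk0]
    rw [ZMod.val_cast_of_lt h, Nat.add_sub_cancel]
  · intro u _
    have := (ZMod.val_ne_zero (u : ZMod p)).2 u.ne_zero
    apply Units.ext
    simp only [Units.val_mk0]
    rw [Nat.sub_add_cancel (by omega), ZMod.natCast_zmod_val]

theorem sum_pow {l : ℕ} (h : ¬ (p - 1) ∣ l) :
    PrimePowDvd p 1 (∑ j ∈ range (p - 1), ((j : ℚ) + 1) ^ l) := by
  have := intCast_of_zmod_eq_zero (p := p) (z := ∑ j ∈ range (p - 1), ((j : ℤ) + 1) ^ l) (by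
    have := sum_pow_zmod (p := p) l
    rw [if_neg h] at this
    push_cast at this ⊢
    exact this)
  push_cast at this
  exact this

theorem sum_pow_sub_one_add_one :
    PrimePowDvd p 1 (∑ j ∈ range (p - 1), ((j : ℚ) + 1) ^ (p - 1) + 1) := by
  have := intCast_of_zmod_eq_zero (p := p) (z := ∑ j ∈ range (p - 1), ((j : ℤ) + 1) ^ (p - 1) + 1)
    (by
      have := sum_pow_zmod (p := p) (p - 1)
      rw [if_pos dvd_rfl] at this
      push_cast at this ⊢
      rw [this, neg_add_cancel])
  push_cast at this
  exact this

/-- The recursion for `bernoulli' r` divides only by integers up to `r + 1 < p`. -/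
theorem bernoulli {r : ℕ} (hr : r < p - 1) : PrimePowDvd p 0 (bernoulli r) := by
  have h' : PrimePowDvd p 0 (bernoulli' r) := by
    induction r using Nat.strong_induction_on with
    | _ r ih =>
      rw [bernoulli'_def]
      refine one.sub (sum fun k hk => ?_)
      have hk := mem_range.1 hk
      rw [div_eq_mul_inv]
      refine ((natCast _).mul_right ?_).mul_right (ih k hk (hk.trans hr))
      have := inv_natCast_of_lt (p := p) (k := r - k + 1) (by omega) (by omega)
      rwa [Nat.cast_add, Nat.cast_sub hk.le, Nat.cast_one] at this
  rw [_root_.bernoulli]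
  exact (one.neg.pow r).mul_left h'

end PrimePowDvd

/-! ### Harmonic sums and alternating binomial sums -/

/-- The generalized harmonic number `∑_{i=1}^n 1 / i^a`. -/
def powerHarmonic (a n : ℕ) : ℚ := ∑ i ∈ range n, 1 / ((i : ℚ) + 1) ^ a

/-- The multiple harmonic sum `∑_{1 ≤ i < j ≤ n} 1 / (i^a j^b)`. -/
def doubleHarmonic (a b n : ℕ) : ℚ := ∑ j ∈ range n, powerHarmonic a j / ((j : ℚ) + 1) ^ b

/-- The sum `∑_{k=1}^n (-1)^(k-1) C(n,k) / k^m`. -/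
def alternatingHarmonic (m n : ℕ) : ℚ :=
  ∑ k ∈ range n, (-1) ^ k * (n.choose (k + 1) : ℚ) / ((k : ℚ) + 1) ^ m

theorem powerHarmonic_succ (a n : ℕ) :
    powerHarmonic a (n + 1) = powerHarmonic a n + 1 / ((n : ℚ) + 1) ^ a :=
  sum_range_succ _ _

/-- This is the recursion of the complete homogeneous symmetric polynomials in `1, 1/2, …, 1/n`. The
lemmas below are therefore their expressions in power sums. -/
theorem alternatingHarmonic_succ_succ (m n : ℕ) :
    alternatingHarmonic (m + 1) (n + 1) =
      alternatingHarmonic (m + 1) n + alternatingHarmonic m (n + 1) / (n + 1) := by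
  have h : alternatingHarmonic (m + 1) n = ∑ k ∈ range (n + 1),
      (-1) ^ k * (n.choose (k + 1) : ℚ) / ((k : ℚ) + 1) ^ (m + 1) := by
    rw [alternatingHarmonic, sum_range_succ]
    simp
  rw [h, alternatingHarmonic, alternatingHarmonic, sum_div, ← sum_add_distrib]
  refine sum_congr rfl fun k _ => ?_
  have hc : ((n : ℚ) + 1) * n.choose k = (n + 1).choose (k + 1) * (k + 1) := by
    exact_mod_cast Nat.add_one_mul_choose_eq n k
  have hp : ((n + 1).choose (k + 1) : ℚ) = n.choose k + n.choose (k + 1) := by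
    exact_mod_cast Nat.choose_succ_succ n k
  have hk : (k : ℚ) + 1 ≠ 0 := by positivity
  have hn : (n : ℚ) + 1 ≠ 0 := by positivity
  field_simp
  linear_combination ((k : ℚ) + 1) ^ m * (((n : ℚ) + 1) * hp + hc)

theorem alternatingHarmonic_zero_left (n : ℕ) : alternatingHarmonic 0 (n + 1) = 1 := by
  have h := Int.alternating_sum_range_choose_of_ne (n.succ_ne_zero)
  rw [sum_range_succ'] at h
  have h' : ∑ k ∈ range (n + 1), ((-1) ^ (k + 1) * ((n + 1).choose (k + 1)) : ℚ) + 1 = 0 := by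
    have := congrArg (Int.cast (R := ℚ)) h
    push_cast at this
    simpa using this
  have h2 : alternatingHarmonic 0 (n + 1) =
      -∑ k ∈ range (n + 1), ((-1) ^ (k + 1) * ((n + 1).choose (k + 1)) : ℚ) := by
    rw [alternatingHarmonic, ← sum_neg_distrib]
    refine sum_congr rfl fun k _ => ?_
    ring
  rw [h2]
  linarith

theorem alternatingHarmonic_one (n : ℕ) : alternatingHarmonic 1 n = powerHarmonic 1 n := by
  induction n with
  | zero => simp [alternatingHarmonic, powerHarmonic]
  | succ n ih =>
    rw [alternatingHarmonic_succ_succ, alternatingHarmonic_zero_left, powerHarmonic_succ, ih,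
      pow_one]

theorem alternatingHarmonic_two (n : ℕ) :
    alternatingHarmonic 2 n = (powerHarmonic 1 n ^ 2 + powerHarmonic 2 n) / 2 := by
  induction n with
  | zero => simp [alternatingHarmonic, powerHarmonic]
  | succ n ih =>
    rw [alternatingHarmonic_succ_succ, alternatingHarmonic_one, ih]
    simp only [powerHarmonic_succ]
    have hn : (n : ℚ) + 1 ≠ 0 := by positivity
    field_simp
    ring

theorem alternatingHarmonic_three (n : ℕ) :
    alternatingHarmonic 3 n = (powerHarmonic 1 n ^ 3 + 3 * powerHarmonic 1 n * powerHarmonic 2 n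
      + 2 * powerHarmonic 3 n) / 6 := by
  induction n with
  | zero => simp [alternatingHarmonic, powerHarmonic]
  | succ n ih =>
    rw [alternatingHarmonic_succ_succ, alternatingHarmonic_two, ih]
    simp only [powerHarmonic_succ]
    have hn : (n : ℚ) + 1 ≠ 0 := by positivity
    field_simp
    ring

theorem alternatingHarmonic_four (n : ℕ) :
    alternatingHarmonic 4 n = (powerHarmonic 1 n ^ 4
      + 6 * powerHarmonic 1 n ^ 2 * powerHarmonic 2 n + 3 * powerHarmonic 2 n ^ 2
      + 8 * powerHarmonic 1 n * powerHarmonic 3 n + 6 * powerHarmonic 4 n) / 24 := by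
  induction n with
  | zero => simp [alternatingHarmonic, powerHarmonic]
  | succ n ih =>
    rw [alternatingHarmonic_succ_succ, alternatingHarmonic_three, ih]
    simp only [powerHarmonic_succ]
    have hn : (n : ℚ) + 1 ≠ 0 := by positivity
    field_simp
    ring

/-! ### Harmonic sums modulo powers of `p` -/

namespace PrimePowDvd

variable {p : ℕ} [hp : Fact p.Prime]

theorem inv_add_one {j : ℕ} (hj : j + 1 < p) : PrimePowDvd p 0 (((j : ℚ) + 1)⁻¹) := by
  have := inv_natCast_of_lt (p := p) j.succ_pos hj
  rwa [Nat.cast_succ] at this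

theorem inv_add_one_pow {j : ℕ} (hj : j + 1 < p) (a : ℕ) :
    PrimePowDvd p 0 (1 / ((j : ℚ) + 1) ^ a) := by
  rw [one_div, ← inv_pow]
  exact (inv_add_one hj).pow a

theorem powerHarmonic (a : ℕ) {n : ℕ} (hn : n < p) : PrimePowDvd p 0 (powerHarmonic a n) :=
  sum fun i hi => inv_add_one_pow (by have := mem_range.1 hi; omega) a

theorem add_one_pow_sub_inv_pow {j a : ℕ} (hj : j + 1 < p) (ha : a < p) :
    PrimePowDvd p 1 (((j : ℚ) + 1) ^ (p - 1 - a) - 1 / ((j : ℚ) + 1) ^ a) := by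
  have := pow_sub_inv_pow (p := p) j.succ_pos hj ha
  rwa [Nat.cast_succ] at this

theorem powerHarmonic_sub_one {a : ℕ} (h0 : 0 < a) (ha : a < p - 1) :
    PrimePowDvd p 1 (_root_.powerHarmonic a (p - 1)) := by
  have h1 : PrimePowDvd p 1 (∑ j ∈ range (p - 1),
      (((j : ℚ) + 1) ^ (p - 1 - a) - 1 / ((j : ℚ) + 1) ^ a)) :=
    sum fun j hj => add_one_pow_sub_inv_pow (by have := mem_range.1 hj; omega) (by omega)
  have h2 := sum_pow (p := p) (l := p - 1 - a)
    (fun h => by have := Nat.le_of_dvd (by omega) h; omega)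
  convert h2.sub h1 using 1
  rw [sum_sub_distrib, _root_.powerHarmonic]
  ring

/-- Fermat turns the negative powers into positive ones, and Faulhaber's formula expands the inner
sum. Modulo `p`, only the outer power sum with exponent `p - 1` survives, with value `-1`. -/
theorem doubleHarmonic_add_bernoulli {a b : ℕ} (ha : 0 < a) (hb : 0 < b) (hab : a + b < p) :
    PrimePowDvd p 1 (doubleHarmonic a b (p - 1) +
      _root_.bernoulli (p - a - b) * ((p - a).choose b : ℚ) / ((p : ℚ) - a)) := by
  have hpa : ((p - 1 - a : ℕ) : ℚ) + 1 = (p : ℚ) - a := by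
    rw [← Nat.cast_succ, ← Nat.cast_sub (by omega)]
    congr 1
    omega
  have hpa' : PrimePowDvd p 0 (((p : ℚ) - a)⁻¹) := by
    rw [← Nat.cast_sub (by omega)]
    exact inv_natCast_of_lt (by omega) (by omega)
  set c : ℕ → ℚ := fun r => _root_.bernoulli r * ((p - a).choose r : ℚ) / ((p : ℚ) - a) with hc
  have hcint (r) (hr : r ∈ range (p - a)) : PrimePowDvd p 0 (c r) := by
    have := mem_range.1 hr
    rw [hc]
    simp only
    rw [div_eq_mul_inv]
    exact ((bernoulli (by omega)).mul_left (natCast _)).mul_left hpa'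
  have h1 : PrimePowDvd p 1 (∑ j ∈ range (p - 1),
      ((∑ i ∈ range j, ((i : ℚ) + 1) ^ (p - 1 - a)) * ((j : ℚ) + 1) ^ (p - 1 - b)
        - _root_.powerHarmonic a j / ((j : ℚ) + 1) ^ b)) := by
    refine sum fun j hj => ?_
    have hj : j + 1 < p := by have := mem_range.1 hj; omega
    have e1 : PrimePowDvd p 1 (∑ i ∈ range j, (((i : ℚ) + 1) ^ (p - 1 - a)
        - 1 / ((i : ℚ) + 1) ^ a)) :=
      sum fun i hi => add_one_pow_sub_inv_pow (by have := mem_range.1 hi; omega) (by omega)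
    have e2 := add_one_pow_sub_inv_pow (p := p) (a := b) hj (by omega)
    have e3 : PrimePowDvd p 0 (((j : ℚ) + 1) ^ (p - 1 - b)) := by
      have := (natCast (p := p) (j + 1)).pow (p - 1 - b)
      rwa [Nat.cast_succ] at this
    convert (e1.mul_right e3).add ((powerHarmonic (p := p) a (n := j) (by omega)).mul_left e2)
      using 1
    rw [sum_sub_distrib, _root_.powerHarmonic]
    ring
  have h2 : ∑ j ∈ range (p - 1),
      (∑ i ∈ range j, ((i : ℚ) + 1) ^ (p - 1 - a)) * ((j : ℚ) + 1) ^ (p - 1 - b) =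
      ∑ r ∈ range (p - a),
        c r * ∑ j ∈ range (p - 1), ((j : ℚ) + 1) ^ (p - a - r + (p - 1 - b)) := by
    simp_rw [mul_sum]
    rw [sum_comm]
    refine sum_congr rfl fun j _ => ?_
    have hF := sum_range_pow (j + 1) (p - 1 - a)
    rw [sum_range_succ', Nat.cast_zero, zero_pow (by omega), add_zero, hpa,
      show p - 1 - a + 1 = p - a by omega] at hF
    push_cast at hF
    rw [hF, sum_mul]
    refine sum_congr rfl fun r _ => ?_
    rw [hc]
    simp only
    rw [pow_add]
    ring
  have hmem : p - a - b ∈ range (p - a) := by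
    rw [mem_range]
    omega
  have h3 : PrimePowDvd p 1 (∑ r ∈ (range (p - a)).erase (p - a - b),
      c r * ∑ j ∈ range (p - 1), ((j : ℚ) + 1) ^ (p - a - r + (p - 1 - b))) := by
    refine sum fun r hr => ?_
    obtain ⟨hne, hr⟩ := mem_erase.1 hr
    refine (hcint r hr).mul_left (sum_pow ?_)
    -- The exponent lies strictly between `0` and `2(p - 1)`, and it equals `p - 1` only for the
    -- erased index.
    rintro ⟨k, hk⟩
    have hr := mem_range.1 hr
    rcases k with - | - | k
    · omega
    · omega
    · have : (p - 1) * (k + 2) = (p - 1) * k + (p - 1) + (p - 1) := by ring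
      rw [add_assoc, this] at hk
      omega
  have h4 := (hcint _ hmem).mul_left (sum_pow_sub_one_add_one (p := p))
  have h5 : p - a - (p - a - b) + (p - 1 - b) = p - 1 := by omega
  rw [sum_sub_distrib, h2, ← add_sum_erase _ _ hmem, h5] at h1
  convert (h3.add h4).sub h1 using 1
  rw [doubleHarmonic]
  have h6 : (p - a).choose b = (p - a).choose (p - a - b) :=
    (Nat.choose_symm (by omega)).symm
  rw [h6]
  change _ + c (p - a - b) = _
  ring

/-- Reflect `i ↦ p - i` and expand `1 / (p - i)` geometrically; the remainder is `p⁵ / (i⁵ (p -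
i))`. -/
theorem two_mul_powerHarmonic_one :
    PrimePowDvd p 5 (2 * _root_.powerHarmonic 1 (p - 1) + p * _root_.powerHarmonic 2 (p - 1)
      + p ^ 2 * _root_.powerHarmonic 3 (p - 1) + p ^ 3 * _root_.powerHarmonic 4 (p - 1)
      + p ^ 4 * _root_.powerHarmonic 5 (p - 1)) := by
  have hr : _root_.powerHarmonic 1 (p - 1) =
      ∑ j ∈ range (p - 1), 1 / ((p : ℚ) - (j + 1)) ^ 1 := by
    rw [_root_.powerHarmonic, ← sum_range_reflect]
    refine sum_congr rfl fun j hj => ?_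
    have := mem_range.1 hj
    congr 2
    rw [← Nat.cast_succ, ← Nat.cast_succ, ← Nat.cast_sub (by omega)]
    congr 1
    omega
  rw [two_mul]
  nth_rw 1 [hr]
  simp only [_root_.powerHarmonic, mul_sum, ← sum_add_distrib]
  refine sum fun j hj => ?_
  have hj := mem_range.1 hj
  have hj1 : (j : ℚ) + 1 ≠ 0 := by positivity
  have hj2 : (p : ℚ) - (j + 1) ≠ 0 := by
    rw [← Nat.cast_succ, sub_ne_zero]
    exact_mod_cast (by omega : p ≠ j + 1)
  have hi : PrimePowDvd p 0 (((p : ℚ) - (j + 1))⁻¹) := by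
    rw [← Nat.cast_succ, ← Nat.cast_sub (by omega)]
    exact inv_natCast_of_lt (by omega) (by omega)
  convert (prime_pow (p := p) 5).mul_right (hi.mul_left (inv_add_one_pow (p := p) (j := j)
    (by omega) 5)) using 1
  field_simp
  ring

theorem two_mul_powerHarmonic_three :
    PrimePowDvd p 3 (2 * _root_.powerHarmonic 3 (p - 1) + 3 * p * _root_.powerHarmonic 4 (p - 1)
      + 6 * p ^ 2 * _root_.powerHarmonic 5 (p - 1)) := by
  have hr : _root_.powerHarmonic 3 (p - 1) =
      ∑ j ∈ range (p - 1), 1 / ((p : ℚ) - (j + 1)) ^ 3 := by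
    rw [_root_.powerHarmonic, ← sum_range_reflect]
    refine sum_congr rfl fun j hj => ?_
    have := mem_range.1 hj
    congr 2
    rw [← Nat.cast_succ, ← Nat.cast_succ, ← Nat.cast_sub (by omega)]
    congr 1
    omega
  rw [two_mul]
  nth_rw 1 [hr]
  simp only [_root_.powerHarmonic, mul_sum, ← sum_add_distrib]
  refine sum fun j hj => ?_
  have hj := mem_range.1 hj
  have hj1 : (j : ℚ) + 1 ≠ 0 := by positivity
  have hj2 : (p : ℚ) - (j + 1) ≠ 0 := by
    rw [← Nat.cast_succ, sub_ne_zero]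
    exact_mod_cast (by omega : p ≠ j + 1)
  have hi : PrimePowDvd p 0 (((p : ℚ) - (j + 1))⁻¹) := by
    rw [← Nat.cast_succ, ← Nat.cast_sub (by omega)]
    exact inv_natCast_of_lt (by omega) (by omega)
  -- Numerator of the remainder after three terms of the expansion of `1 / (p - i)³` in powers of
  -- `p`.
  have hz : PrimePowDvd p 0
      ((10 * ((j : ℤ) + 1) ^ 2 - 15 * p * ((j : ℤ) + 1) + 6 * p ^ 2 : ℤ) : ℚ) := intCast _
  convert (prime_pow (p := p) 3).mul_right (hz.mul_left ((hi.pow 3).mul_left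
    (inv_add_one_pow (p := p) (j := j) (by omega) 5))) using 1
  push_cast
  field_simp
  ring

end PrimePowDvd

/-! ### Expansions in powers of `p` and the Bernoulli number `B_{p-5}` -/

theorem squareProd_succ (x : ℚ) (n : ℕ) :
    squareProd x (n + 1) = squareProd x n * (x / ((n : ℚ) + 1) ^ 2 - 1) :=
  prod_range_succ _ _

namespace PrimePowDvd

variable {p : ℕ} [hp : Fact p.Prime]

theorem squareProd_sq_sub {n : ℕ} (hn : n < p) :
    PrimePowDvd p 6 (squareProd ((p : ℚ) ^ 2) n ^ 2 - (1 - 2 * p ^ 2 * _root_.powerHarmonic 2 n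
      + p ^ 4 * (2 * _root_.powerHarmonic 2 n ^ 2 - _root_.powerHarmonic 4 n))) := by
  induction n with
  | zero =>
    convert zero (p := p) (m := 6) using 1
    simp [squareProd, _root_.powerHarmonic]
  | succ n ih =>
    have hH := powerHarmonic (p := p) 2 (n := n) (by omega)
    have hK := powerHarmonic (p := p) 4 (n := n) (by omega)
    have hy := inv_add_one_pow (p := p) (j := n) hn 2
    have hP := natCast (p := p) p
    have h4 : _root_.powerHarmonic 4 (n + 1) =
        _root_.powerHarmonic 4 n + (1 / ((n : ℚ) + 1) ^ 2) ^ 2 := by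
      have : ((n : ℚ) + 1) ^ 4 = (((n : ℚ) + 1) ^ 2) ^ 2 := by ring
      rw [powerHarmonic_succ, this, div_pow, one_pow]
    have hd : (p : ℚ) ^ 2 / ((n : ℚ) + 1) ^ 2 = p ^ 2 * (1 / ((n : ℚ) + 1) ^ 2) := by ring
    rw [squareProd_succ, powerHarmonic_succ, h4, hd]
    generalize _root_.powerHarmonic 2 n = H at *
    generalize _root_.powerHarmonic 4 n = K at *
    generalize 1 / ((n : ℚ) + 1) ^ 2 = y at *
    have hL : PrimePowDvd p 0 (2 * H ^ 2 - K) := ((ofNat 2).mul_left (hH.pow 2)).sub hK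
    have hr : PrimePowDvd p 0 ((2 * H ^ 2 - K) * (p ^ 2 * y ^ 2 - 2 * y) - 2 * H * y ^ 2) :=
      (hL.mul_left (((hP.pow 2).mul_left (hy.pow 2)).sub ((ofNat 2).mul_left hy))).sub
        (((ofNat 2).mul_left hH).mul_left (hy.pow 2))
    convert ((ih (by omega)).mul_right
      ((((hP.pow 2).mul_left hy).sub one).pow 2)).add ((prime_pow 6).mul_right hr) using 1
    ring

theorem neg_one_pow_mul_choose_sub {k : ℕ} (hk : k < p) :
    PrimePowDvd p 2 ((-1) ^ k * ((p - 1).choose k : ℚ)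
      - (1 - p * _root_.powerHarmonic 1 k)) := by
  induction k with
  | zero =>
    convert zero (p := p) (m := 2) using 1
    simp [_root_.powerHarmonic]
  | succ k ih =>
    have hH := powerHarmonic (p := p) 1 (n := k) (by omega)
    have hy := inv_add_one (p := p) (j := k) hk
    have hc : ((p - 1).choose (k + 1) : ℚ) = (p - 1).choose k * (p * ((k : ℚ) + 1)⁻¹ - 1) := by
      have h := Nat.choose_succ_right_eq (p - 1) k
      have h' : ((p - 1).choose (k + 1) : ℚ) * (k + 1) = (p - 1).choose k * (p - (k + 1)) := by
        rw [← Nat.cast_succ, ← Nat.cast_sub hk.le, show p - (k + 1) = p - 1 - k by omega]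
        exact_mod_cast h
      have hk1 : (k : ℚ) + 1 ≠ 0 := by positivity
      field_simp
      linear_combination h'
    rw [hc, powerHarmonic_succ, pow_one, one_div]
    convert ((ih (by omega)).mul_right (one.sub ((natCast p).mul_left hy))).add
      ((prime_pow 2).mul_right (hH.mul_left hy)) using 1
    ring

theorem alternatingHarmonic_four_add (h : 7 ≤ p) :
    PrimePowDvd p 2 (alternatingHarmonic 4 (p - 1) + _root_.powerHarmonic 4 (p - 1)
      - p * doubleHarmonic 1 4 (p - 1)) := by
  have h5 := powerHarmonic_sub_one (p := p) (a := 5) (by omega) (by omega)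
  have hs : PrimePowDvd p 2 (∑ k ∈ range (p - 1),
      ((-1) ^ (k + 1) * ((p - 1).choose (k + 1) : ℚ)
        - (1 - p * _root_.powerHarmonic 1 (k + 1))) * (1 / ((k : ℚ) + 1) ^ 4)) := by
    refine sum fun k hk => ?_
    have hk := mem_range.1 hk
    exact (neg_one_pow_mul_choose_sub (by omega)).mul_right (inv_add_one_pow (by omega) 4)
  convert ((prime_pow (p := p) 1).mul h5).sub hs using 1
  rw [alternatingHarmonic, doubleHarmonic]
  simp only [_root_.powerHarmonic_succ]
  have e (a : ℕ) : _root_.powerHarmonic a (p - 1) =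
      ∑ i ∈ range (p - 1), 1 / ((i : ℚ) + 1) ^ a := rfl
  rw [e 4, e 5, mul_sum, mul_sum, ← sum_add_distrib, ← sum_sub_distrib, ← sum_sub_distrib]
  refine sum_congr rfl fun k _ => ?_
  have hk1 : (k : ℚ) + 1 ≠ 0 := by positivity
  field_simp
  ring

theorem inv_ofNat (k : ℕ) [k.AtLeastTwo] (h : ¬ p ∣ k) : PrimePowDvd p 0 ((ofNat(k) : ℚ)⁻¹) :=
  inv_natCast h

theorem not_dvd_twenty_four (h : 7 ≤ p) : ¬ p ∣ 24 := by
  intro hd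
  rw [show 24 = 2 ^ 3 * 3 by norm_num, hp.out.dvd_mul] at hd
  rcases hd with hd | hd
  · have := Nat.le_of_dvd (by omega) (hp.out.dvd_of_dvd_pow hd)
    omega
  · have := Nat.le_of_dvd (by omega) hd
    omega

theorem doubleHarmonic_one_four (h : 7 ≤ p) :
    PrimePowDvd p 1 (doubleHarmonic 1 4 (p - 1) - _root_.bernoulli (p - 5)) := by
  have hd := doubleHarmonic_add_bernoulli (p := p) (a := 1) (b := 4) (by omega) (by omega)
    (by omega)
  have hB := bernoulli (p := p) (r := p - 5) (by omega)
  have hc : ((p - 1).choose 4 : ℚ) * 24 = (p - 1) * (p - 2) * (p - 3) * (p - 4) := by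
    obtain ⟨q, rfl⟩ := Nat.exists_eq_add_of_le' h
    have := Nat.descFactorial_eq_factorial_mul_choose (q + 6) 4
    simp [Nat.descFactorial, Nat.factorial] at this
    have := congrArg (Nat.cast (R := ℚ)) this
    push_cast at this ⊢
    linear_combination -this
  have hp1 : (p : ℚ) - 1 ≠ 0 := by
    rw [sub_ne_zero]
    exact_mod_cast hp.out.ne_one
  -- From `(p-2)(p-3)(p-4) + 24 = p (p² - 9p + 26)`, so the binomial quotient is `-1` modulo `p`.
  have hz : PrimePowDvd p 0 (((p : ℤ) ^ 2 - 9 * p + 26 : ℤ) : ℚ) := intCast _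
  rw [Nat.sub_sub] at hd
  convert hd.sub ((prime_pow (p := p) 1).mul_right
    (hB.mul_left (hz.mul_left (inv_ofNat 24 (not_dvd_twenty_four h))))) using 1
  push_cast
  field_simp
  linear_combination (-_root_.bernoulli (p - 5)) * hc

theorem doubleHarmonic_two_three (h : 7 ≤ p) :
    PrimePowDvd p 1 (doubleHarmonic 2 3 (p - 1) + 2 * _root_.bernoulli (p - 5)) := by
  have hd := doubleHarmonic_add_bernoulli (p := p) (a := 2) (b := 3) (by omega) (by omega)
    (by omega)
  have hB := bernoulli (p := p) (r := p - 5) (by omega)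
  have hc : ((p - 2).choose 3 : ℚ) * 6 = (p - 2) * (p - 3) * (p - 4) := by
    obtain ⟨q, rfl⟩ := Nat.exists_eq_add_of_le' h
    have := Nat.descFactorial_eq_factorial_mul_choose (q + 5) 3
    simp [Nat.descFactorial, Nat.factorial] at this
    have := congrArg (Nat.cast (R := ℚ)) this
    push_cast at this ⊢
    linear_combination -this
  have hp1 : (p : ℚ) - 2 ≠ 0 := by
    rw [sub_ne_zero]
    exact_mod_cast (by omega : p ≠ 2)
  have hz : PrimePowDvd p 0 (((p : ℤ) - 7 : ℤ) : ℚ) := intCast _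
  have h6 : ¬ p ∣ 6 := fun h' => by
    have := Nat.le_of_dvd (by omega) h'
    omega
  rw [Nat.sub_sub] at hd
  convert hd.sub ((prime_pow (p := p) 1).mul_right
    (hB.mul_left (hz.mul_left (inv_ofNat 6 h6)))) using 1
  push_cast
  field_simp
  linear_combination (-_root_.bernoulli (p - 5)) * hc

/-- Evaluate the alternating sum of weight 4 twice modulo `p ^ 2`. In power sums, every product of
two sums drops out, leaving `H₄ / 4`; expanding the binomials gives `-H₄ + p H(1,4)`. Hence `(5/4)
H₄ ≡ p B_{p-5}`. -/
theorem powerHarmonic_four (h : 7 ≤ p) :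
    PrimePowDvd p 2 (_root_.powerHarmonic 4 (p - 1) - 4 / 5 * p * _root_.bernoulli (p - 5)) := by
  have h1 := powerHarmonic_sub_one (p := p) (a := 1) (by omega) (by omega)
  have h2 := powerHarmonic_sub_one (p := p) (a := 2) (by omega) (by omega)
  have h3 := powerHarmonic_sub_one (p := p) (a := 3) (by omega) (by omega)
  have hA := alternatingHarmonic_four_add h
  have hD := (prime_pow (p := p) 1).mul (doubleHarmonic_one_four h)
  have h5 : PrimePowDvd p 0 (5 : ℚ)⁻¹ := inv_ofNat 5 fun h' => by
    have := Nat.le_of_dvd (by omega) h'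
    omega
  have h6 : PrimePowDvd p 0 (6 : ℚ)⁻¹ := inv_ofNat 6 fun h' => by
    have := Nat.le_of_dvd (by omega) h'
    omega
  rw [alternatingHarmonic_four] at hA
  generalize _root_.powerHarmonic 1 (p - 1) = H1 at *
  generalize _root_.powerHarmonic 2 (p - 1) = H2 at *
  generalize _root_.powerHarmonic 3 (p - 1) = H3 at *
  have i1 := h1.mono zero_le_one
  have hN : PrimePowDvd p 2 (H1 ^ 4 + 6 * H1 ^ 2 * H2 + 3 * H2 ^ 2 + 8 * H1 * H3) := by
    convert ((h1.mul h1).mul_right (i1.pow 2)).add (((((ofNat 6).mul_left i1).mul_left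
      (h1.mul h2)).add ((ofNat 3).mul_left (h2.mul h2))).add ((ofNat 8).mul_left (h1.mul h3)))
      using 1
    ring
  convert h5.mul_left ((ofNat 4).mul_left ((hA.add hD).sub
    (h6.mul_left ((inv_ofNat 4 (fun h' => by
      have := Nat.le_of_dvd (by omega) h'
      omega)).mul_left hN)))) using 1
  ring

theorem sum_squareProd_sq_div_cube :
    PrimePowDvd p 4 (∑ j ∈ range (p - 1), squareProd ((p : ℚ) ^ 2) j ^ 2 / ((j : ℚ) + 1) ^ 3
      - (_root_.powerHarmonic 3 (p - 1) - 2 * p ^ 2 * doubleHarmonic 2 3 (p - 1))) := by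
  nth_rw 1 [_root_.powerHarmonic]
  rw [doubleHarmonic, mul_sum, ← sum_sub_distrib, ← sum_sub_distrib]
  refine sum fun j hj => ?_
  have hj := mem_range.1 hj
  have hH := powerHarmonic (p := p) 2 (n := j) (by omega)
  have hK := powerHarmonic (p := p) 4 (n := j) (by omega)
  convert (((squareProd_sq_sub (p := p) (n := j) (by omega)).mono (m := 4) (by norm_num)).add
    ((prime_pow 4).mul_right (((ofNat 2).mul_left (hH.pow 2)).sub hK))).mul_right
      (inv_add_one_pow (p := p) (j := j) (by omega) 3) using 1
  ring

end PrimePowDvd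

/-! ### Assembling the congruence -/

theorem harmonic_eq_powerHarmonic_one (n : ℕ) : harmonic n = powerHarmonic 1 n := by
  simp [harmonic, powerHarmonic]

open PrimePowDvd in
theorem ratModEqPrimePow_sum_aperyNumber_of_seven_le {p : ℕ} [hp : Fact p.Prime] (h : 7 ≤ p) :
    RatModEqPrimePow p 9
      (∑ k ∈ Finset.range p, (2 * (k : ℚ) + 1) ^ 3 * (aperyNumber k : ℚ))
      ((p : ℚ) ^ 3 + 4 * (p : ℚ) ^ 4 * harmonic (p - 1)
        + 6 / 5 * (p : ℚ) ^ 8 * bernoulli (p - 5)) := by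
  change PrimePowDvd p 9 _
  have hQ := (prime_pow 3).mul
    (squareProd_sq_sub (p := p) (n := p - 1) (by omega))
  have hS := (prime_pow (p := p) 5).mul sum_squareProd_sq_div_cube
  have h2 := powerHarmonic_sub_one (p := p) (a := 2) (by omega) (by omega)
  have h5 := powerHarmonic_sub_one (p := p) (a := 5) (by omega) (by omega)
  have hc := (prime_pow (p := p) 4).mul two_mul_powerHarmonic_one
  have hd := (prime_pow (p := p) 6).mul two_mul_powerHarmonic_three
  have hf := (prime_pow (p := p) 8).mul (doubleHarmonic_two_three h)
  have hg := (prime_pow (p := p) 7).mul (powerHarmonic_four h)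
  have h22 := (prime_pow (p := p) 7).mul (h2.mul h2)
  have h85 := (prime_pow (p := p) 8).mul h5
  have i2 : PrimePowDvd p 0 (2 : ℚ)⁻¹ := inv_ofNat 2 fun h' => by
    have := Nat.le_of_dvd (by omega) h'
    omega
  have hsum : ∑ j ∈ range p, squareProd ((p : ℚ) ^ 2) j ^ 2 / ((j : ℚ) + 1) ^ 3 =
      ∑ j ∈ range (p - 1), squareProd ((p : ℚ) ^ 2) j ^ 2 / ((j : ℚ) + 1) ^ 3 +
        squareProd ((p : ℚ) ^ 2) (p - 1) ^ 2 / (p : ℚ) ^ 3 := by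
    conv_lhs => rw [← Nat.sub_add_cancel hp.out.one_le, sum_range_succ]
    rw [Nat.cast_sub hp.out.one_le, Nat.cast_one, sub_add_cancel]
    simp only [Nat.sub_add_cancel hp.out.one_le]
  have hp0 : (p : ℚ) ≠ 0 := Nat.cast_ne_zero.2 hp.out.ne_zero
  rw [sum_odd_cube_mul_aperyNumber, hsum, harmonic_eq_powerHarmonic_one]
  -- `-2 * hc` replaces `-2p⁵H₂` by `4p⁴H₁` plus higher terms, and `(3/2) * hd` then removes the
  -- resulting `3p⁶H₃`. This leaves `-(7/2) p⁷H₄ - 2p⁸H(2,3)`, and `-14/5 + 4 = 6/5`.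
  convert ((((hQ.add ((natCast p).mul_left hS)).add ((ofNat 2).mul_left h22)).sub
    ((ofNat 2).mul_left hc)).add (i2.mul_left ((ofNat 3).mul_left hd))).sub
    (((i2.mul_left ((ofNat 7).mul_left hg)).add ((ofNat 2).mul_left hf)).add
      ((ofNat 7).mul_left h85)) using 1
  field_simp
  ring

theorem ratModEqPrimePow_sum_aperyNumber_five :
    RatModEqPrimePow 5 9
      (∑ k ∈ Finset.range 5, (2 * (k : ℚ) + 1) ^ 3 * (aperyNumber k : ℚ))
      (((5 : ℕ) : ℚ) ^ 3 + 4 * ((5 : ℕ) : ℚ) ^ 4 * harmonic (5 - 1)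
        + 6 / 5 * ((5 : ℕ) : ℚ) ^ 8 * bernoulli (5 - 5)) := by
  have h0 : aperyNumber 0 = 1 := by decide
  have h1 : aperyNumber 1 = 5 := by decide
  have h2 : aperyNumber 2 = 73 := by decide
  have h3 : aperyNumber 3 = 1445 := by decide
  have h4 : aperyNumber 4 = 33001 := by decide
  -- The exact difference of the two sides divided by `5 ^ 9`.
  refine ⟨(37 / 3 : ℚ), ?_, ?_⟩
  · rw [show ((37 : ℚ) / 3).den = 3 by norm_num]
    norm_num
  · norm_num [sum_range_succ, h0, h1, h2, h3, h4, harmonic]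

theorem theorem1p2 (p : ℕ) (hp : p.Prime) (hp5 : 5 ≤ p) :
    RatModEqPrimePow p 9
      (∑ k ∈ Finset.range p, (2 * (k : ℚ) + 1) ^ 3 * (aperyNumber k : ℚ))
      ((p : ℚ) ^ 3 + 4 * (p : ℚ) ^ 4 * harmonic (p - 1)
        + 6 / 5 * (p : ℚ) ^ 8 * bernoulli (p - 5)) := by
  have := Fact.mk hp
  obtain rfl | h6 := hp5.eq_or_lt
  · exact ratModEqPrimePow_sum_aperyNumber_five
  · have : p ≠ 6 := by
      rintro rfl
      norm_num at hp
    exact ratModEqPrimePow_sum_aperyNumber_of_seven_le (by omega)
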